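/- For a prime power $q$ and integers $n,d,k\ge 0$, let $A_q(n,d;k)$ denote the maximum possible cardinality of a set $\mathcal{C}$ of $k$-dimensional subspaces of $\mathbb{F}_q^n$ such that any two distinct $U,W\in\mathcal{C}$ have subspace distance $d_S(U,W):=\dim(U)+\dim(W)-2\dim(U\cap W)\ge d$. Then \[ A_2(14,10;6)\le 67349,\qquad A_2(15,10;7)\le 17727975,\qquad A_2(19,10;6)\le 70329353 . \] -/

import Mathlib

/-- The subspace distance `dim U + dim W - 2 dim (U ∩ W)`. The subtraction of natural numbers does
not truncate, see `subspaceDist_add`. -/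
noncomputable def subspaceDist {F V : Type*} [Field F] [AddCommGroup V] [Module F V]
    (U W : Submodule F V) : ℕ :=
  Module.finrank F U + Module.finrank F W - 2 * Module.finrank F (U ⊓ W : Submodule F V)

theorem subspaceDist_add {F V : Type*} [Field F] [AddCommGroup V] [Module F V]
    [FiniteDimensional F V] (U W : Submodule F V) :
    subspaceDist U W + 2 * Module.finrank F (U ⊓ W : Submodule F V) =
      Module.finrank F U + Module.finrank F W := by
  have h1 : Module.finrank F (U ⊓ W : Submodule F V) ≤ Module.finrank F U :=
    Submodule.finrank_mono inf_le_left
  have h2 : Module.finrank F (U ⊓ W : Submodule F V) ≤ Module.finrank F W :=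
    Submodule.finrank_mono inf_le_right
  unfold subspaceDist
  omega

/-- `C` is a constant-dimension code in `F ^ n`: a set of `k`-dimensional subspaces whose pairwise
subspace distances are at least `d`. -/
def IsConstantDimensionCode {F : Type*} [Field F] {n : ℕ} (d k : ℕ)
    (C : Finset (Submodule F (Fin n → F))) : Prop :=
  (∀ U ∈ C, Module.finrank F U = k) ∧
    ∀ U ∈ C, ∀ W ∈ C, U ≠ W → d ≤ subspaceDist U W

/-- `A_q(n, d; k)` for the finite field `F` with `q` elements: the maximum cardinality of a
constant-dimension code. The maximum is attained, see `isGreatest_maxCodeSize`. -/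
noncomputable def maxCodeSize (F : Type*) [Field F] (n d k : ℕ) : ℕ :=
  sSup {N : ℕ | ∃ C : Finset (Submodule F (Fin n → F)),
    IsConstantDimensionCode d k C ∧ C.card = N}

theorem isGreatest_maxCodeSize (F : Type*) [Field F] [Finite F] (n d k : ℕ) :
    IsGreatest {N : ℕ | ∃ C : Finset (Submodule F (Fin n → F)),
      IsConstantDimensionCode d k C ∧ C.card = N} (maxCodeSize F n d k) := by
  have hb : BddAbove {N : ℕ | ∃ C : Finset (Submodule F (Fin n → F)),
      IsConstantDimensionCode d k C ∧ C.card = N} := by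
    refine ⟨Nat.card (Submodule F (Fin n → F)), ?_⟩
    rintro N ⟨C, -, rfl⟩
    have := Fintype.ofFinite (Submodule F (Fin n → F))
    rw [Nat.card_eq_fintype_card]
    exact Finset.card_le_univ C
  refine ⟨Nat.sSup_mem ⟨0, ∅, ?_, rfl⟩ hb, fun N hN => le_csSup hb hN⟩
  simp [IsConstantDimensionCode]

/-! The distance conditions bound dimensions of intersections. In a family of 6-spaces meeting
pairwise in dimension at most 1, the members through a nonzero vector form, modulo that vector, a
partial spread of 5-spaces, say of size at most `A`. Giving `v` the multiplicity `A` minus the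
number of members through `v` defines a multiset of vectors whose evaluation code is 32-divisible.
One member too many would give length 147 or 135, which residual codes exclude.

The sharp value of `A` comes from the same construction with `A = 1`: a larger partial spread would
have 131 holes, forming a projective 16-divisible code. Moments of its weight distribution and
translation by codewords rule this out. The bound in dimension 15 follows from that in dimension 14
by Johnson's argument. -/

open Finset

universe u

/-! ### Character sums over binary groups. -/

/-- The nontrivial character of the field with two elements. -/
def parityChar : AddChar (ZMod 2) ℤ where
  toFun x := if x = 0 then 1 else -1
  map_zero_eq_one' := by decide
  map_add_eq_mul' := by decide

theorem parityChar_eq (x : ZMod 2) : parityChar x = 1 - 2 * (if x ≠ 0 then 1 else 0) := by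
  revert x; decide

theorem sum_parityChar_comp_eq_zero {G : Type*} [AddGroup G] [Fintype G] (φ : G →+ ZMod 2)
    (h : ∃ g, φ g ≠ 0) : ∑ g, parityChar (φ g) = 0 := by
  obtain ⟨g, hg⟩ := h
  have : parityChar.compAddMonoidHom φ ≠ 1 := by
    intro h1
    have h2 := DFunLike.congr_fun h1 g
    revert h2 hg
    simp only [AddChar.compAddMonoidHom_apply, AddChar.one_apply]
    generalize φ g = x
    revert x; decide
  simpa using AddChar.sum_eq_zero_of_ne_one this

theorem sum_parityChar_comp_nonneg {G : Type*} [AddGroup G] [Fintype G] (φ : G →+ ZMod 2) :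
    0 ≤ ∑ g, parityChar (φ g) := by
  by_cases h : ∃ g, φ g ≠ 0
  · rw [sum_parityChar_comp_eq_zero φ h]
  · push Not at h
    simp [h]

theorem two_mul_card_filter_ne_zero {G : Type*} [AddGroup G] [Fintype G] (φ : G →+ ZMod 2)
    (h : ∃ g, φ g ≠ 0) : 2 * #{g | φ g ≠ 0} = Fintype.card G := by
  have := sum_parityChar_comp_eq_zero φ h
  simp only [parityChar_eq, sum_sub_distrib, ← mul_sum, sum_boole] at this
  simp at this
  have h2 : #{g | φ g ≠ 0} = #{x | ¬ φ x = 0} := rfl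
  omega

/-! ### Residuals and weight moments of binary codes. -/

namespace BinaryCode

section

variable {ι : Type*} {C : Submodule (ZMod 2) (ι → ZMod 2)}

/-- A code without a coordinate that vanishes on all codewords. -/
def IsEffective (C : Submodule (ZMod 2) (ι → ZMod 2)) : Prop :=
  ∀ i, ∃ c ∈ C, c i ≠ 0

/-- A code without repeated coordinates. -/
def IsProjective (C : Submodule (ZMod 2) (ι → ZMod 2)) : Prop :=
  ∀ i j, i ≠ j → ∃ c ∈ C, c i ≠ c j

/-- The restriction of a code to the zero coordinates of a word. -/
def residual (C : Submodule (ZMod 2) (ι → ZMod 2)) (c : ι → ZMod 2) :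
    Submodule (ZMod 2) ({i // c i = 0} → ZMod 2) :=
  C.map (LinearMap.funLeft (ZMod 2) (ZMod 2) Subtype.val)

theorem IsEffective.residual (h : IsEffective C) (c : ι → ZMod 2) :
    IsEffective (residual C c) := by
  rintro ⟨i, hi⟩
  obtain ⟨d, hd, hdi⟩ := h i
  exact ⟨_, Submodule.mem_map_of_mem hd, hdi⟩

theorem IsProjective.residual (h : IsProjective C) (c : ι → ZMod 2) :
    IsProjective (residual C c) := by
  rintro ⟨i, hi⟩ ⟨j, hj⟩ hij
  obtain ⟨d, hd, hdi⟩ := h i j (fun h => hij (Subtype.ext h))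
  exact ⟨_, Submodule.mem_map_of_mem hd, hdi⟩

/-- The restriction of a word to the zero coordinates of a word `c`. -/
def restrict (c d : ι → ZMod 2) : {i // c i = 0} → ZMod 2 := fun i => d i

theorem restrict_mem_residual (c : ι → ZMod 2) {d : ι → ZMod 2} (hd : d ∈ C) :
    restrict c d ∈ residual C c :=
  Submodule.mem_map_of_mem (f := LinearMap.funLeft (ZMod 2) (ZMod 2) Subtype.val) hd

variable [Fintype ι]

/-- The Hamming weight of a binary word. -/
def weight (c : ι → ZMod 2) : ℕ := #{i | c i ≠ 0}

/-- All weights are divisible by `Δ`. -/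
def IsDivisible (Δ : ℕ) (C : Submodule (ZMod 2) (ι → ZMod 2)) : Prop :=
  ∀ c ∈ C, Δ ∣ weight c

/-- The number of zero coordinates minus the number of nonzero coordinates. -/
def bias (c : ι → ZMod 2) : ℤ := ∑ i, parityChar (c i)

theorem bias_eq (c : ι → ZMod 2) : bias c = Fintype.card ι - 2 * weight c := by
  simp only [bias, weight, parityChar_eq, sum_sub_distrib, ← mul_sum, sum_boole]
  simp

@[simp]
theorem weight_zero : weight (0 : ι → ZMod 2) = 0 := by simp [weight]

theorem weight_eq_zero {c : ι → ZMod 2} : weight c = 0 ↔ c = 0 := by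
  simp [weight, funext_iff, filter_eq_empty_iff]

theorem weight_le (c : ι → ZMod 2) : weight c ≤ Fintype.card ι := card_le_univ _

noncomputable instance (C : Submodule (ZMod 2) (ι → ZMod 2)) : Fintype C := Fintype.ofFinite C

/-- Evaluation of codewords at a coordinate. -/
def evalHom (C : Submodule (ZMod 2) (ι → ZMod 2)) (i : ι) : C →+ ZMod 2 where
  toFun c := c.1 i
  map_zero' := rfl
  map_add' _ _ := rfl

theorem sum_bias (h : IsEffective C) : ∑ c : C, bias c.1 = 0 := by
  simp only [bias]
  rw [sum_comm]
  refine sum_eq_zero fun i _ => ?_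
  obtain ⟨c, hc, hi⟩ := h i
  exact sum_parityChar_comp_eq_zero (evalHom C i) ⟨⟨c, hc⟩, hi⟩

/-- Orthogonality: distinct coordinates differ as characters of `C`, so only diagonal terms survive.
-/
theorem sum_bias_sq (h : IsProjective C) :
    ∑ c : C, bias c.1 ^ 2 = Fintype.card ι * Fintype.card C := by
  classical
  have key : ∀ i j, ∑ c : C, parityChar (c.1 i) * parityChar (c.1 j) =
      if i = j then (Fintype.card C : ℤ) else 0 := by
    intro i j
    simp only [← AddChar.map_add_eq_mul]
    split_ifs with hij
    · subst hij
      simp [CharTwo.add_self_eq_zero]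
    · obtain ⟨c, hc, hi⟩ := h i j hij
      refine sum_parityChar_comp_eq_zero (evalHom C i + evalHom C j) ⟨⟨c, hc⟩, ?_⟩
      exact fun h0 => hi (CharTwo.add_eq_zero.mp h0)
  simp only [bias, sq, sum_mul_sum]
  rw [sum_comm]
  simp_rw [sum_comm (s := (univ : Finset C)), key]
  simp

/-- The cube expands into complete character sums, each 0 or `|C|`. -/
theorem sum_bias_cube_nonneg : 0 ≤ ∑ c : C, bias c.1 ^ 3 := by
  have : ∀ c : C, bias c.1 ^ 3 =
      ∑ i, ∑ j, ∑ l, parityChar ((evalHom C i + evalHom C j + evalHom C l) c) := by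
    intro c
    simp only [AddMonoidHom.add_apply, AddChar.map_add_eq_mul]
    simp only [← mul_sum, ← sum_mul]
    rw [pow_succ, sq]
    rfl
  simp only [this]
  rw [sum_comm]
  refine sum_nonneg fun i _ => ?_
  rw [sum_comm]
  refine sum_nonneg fun j _ => ?_
  rw [sum_comm]
  exact sum_nonneg fun l _ => sum_parityChar_comp_nonneg _

/-- Biases sum to 0 and the zero word has positive bias, so some bias is negative. -/
theorem exists_card_lt_two_mul_weight (h : IsEffective C) [Nonempty ι] :
    ∃ c ∈ C, Fintype.card ι < 2 * weight c := by
  by_contra! hc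
  have h0 : ∀ c ∈ (univ : Finset C), 0 ≤ bias c.1 := fun c _ => by
    have := hc c.1 c.2
    rw [bias_eq]; omega
  have h1 := (sum_eq_zero_iff_of_nonneg h0).mp (sum_bias h) 0 (mem_univ _)
  have := Fintype.card_pos (α := ι)
  simp only [bias_eq, Submodule.coe_zero, weight_zero] at h1
  omega

theorem card_zeros (c : ι → ZMod 2) :
    Fintype.card {i // c i = 0} + weight c = Fintype.card ι := by
  classical
  rw [Fintype.card_subtype, weight]
  exact card_filter_add_card_filter_not _

/-- A coordinate in the support of `c` counts in exactly one of `d`, `c + d`; outside it, in both or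
neither. -/
theorem weight_add_weight_add (c d : ι → ZMod 2) :
    weight d + weight (c + d) = weight c + 2 * weight (restrict c d) := by
  have h1 : weight (restrict c d) = #{i | c i = 0 ∧ d i ≠ 0} := by
    refine card_bij (fun i _ => i.1) ?_ ?_ ?_
    · rintro ⟨i, hi⟩ h
      exact mem_filter.mpr ⟨mem_univ _, hi, (mem_filter.mp h).2⟩
    · intro a _ b _ h
      exact Subtype.ext h
    · intro i hi
      simp only [mem_filter, mem_univ, true_and] at hi
      exact ⟨⟨i, hi.1⟩, mem_filter.mpr ⟨mem_univ _, hi.2⟩, rfl⟩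
  have key : ∀ x y : ZMod 2, ((if y ≠ 0 then 1 else 0) + if x + y ≠ 0 then 1 else 0) =
      (if x ≠ 0 then 1 else 0) + 2 * if x = 0 ∧ y ≠ 0 then 1 else 0 := by decide
  rw [h1]
  simp only [weight, card_filter, mul_sum, ← sum_add_distrib]
  refine sum_congr rfl fun i _ => ?_
  exact key (c i) (d i)

theorem weight_add_le (c d : ι → ZMod 2) : weight (c + d) ≤ weight c + weight d := by
  classical
  refine (card_le_card fun i hi => ?_).trans (card_union_le _ _)
  simp only [mem_union, mem_filter, mem_univ, true_and, Pi.add_apply] at hi ⊢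
  by_contra! h
  simp [h.1, h.2] at hi

theorem IsDivisible.residual {Δ : ℕ} (h : IsDivisible (2 * Δ) C) {c : ι → ZMod 2} (hc : c ∈ C) :
    IsDivisible Δ (residual C c) := by
  rintro _ ⟨d, hd, rfl⟩
  change Δ ∣ weight (restrict c d)
  have h1 := weight_add_weight_add c d
  obtain ⟨x, hx⟩ := h c hc
  obtain ⟨y, hy⟩ := h d hd
  obtain ⟨z, hz⟩ := h (c + d) (C.add_mem hc hd)
  rw [hx, hy, hz] at h1
  have h2 : Δ * (y + z) = Δ * x + weight (restrict c d) := by linarith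
  exact (Nat.dvd_add_right (dvd_mul_right _ _)).mp (h2 ▸ dvd_mul_right _ _)

/-- `C` is the union of the fibres of the restriction to the zeros of `c`, which have the same
cardinality. -/
theorem card_eq_card_residual_mul (c : ι → ZMod 2) :
    Fintype.card C = Fintype.card (residual C c) * #{d : C | restrict c d.1 = 0} := by
  classical
  let f : C →+ residual C c :=
    { toFun := fun d => ⟨restrict c d.1, restrict_mem_residual c d.2⟩
      map_zero' := rfl
      map_add' := fun _ _ => rfl }
  have hf : Function.Surjective f := by
    rintro ⟨_, d, hd, rfl⟩
    exact ⟨⟨d, hd⟩, rfl⟩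
  have h1 := AddSubgroup.card_eq_card_quotient_mul_card_addSubgroup f.ker
  rw [Nat.card_congr (QuotientAddGroup.quotientKerEquivOfSurjective f hf).toEquiv] at h1
  rw [← Nat.card_eq_fintype_card, ← Nat.card_eq_fintype_card, h1]
  congr 1
  rw [← Fintype.card_subtype, Nat.card_eq_fintype_card]
  refine Fintype.card_congr (Equiv.subtypeEquivRight fun d => ?_)
  rw [AddMonoidHom.mem_ker, Subtype.ext_iff]
  rfl

end

section

variable {ι : Type u} [Fintype ι] {C : Submodule (ZMod 2) (ι → ZMod 2)}

/-- The number of codewords of weight `w`. -/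
noncomputable def weightCount (C : Submodule (ZMod 2) (ι → ZMod 2)) (w : ℕ) : ℕ :=
  #{c : C | weight c.1 = w}

theorem weightCount_zero : weightCount C 0 = 1 := by
  rw [weightCount, card_eq_one]
  refine ⟨0, ?_⟩
  ext c
  simp [weight_eq_zero]

theorem sum_comp_bias (S : Finset ℕ) (hS : ∀ c ∈ C, weight c ∈ S) (g : ℤ → ℤ) :
    ∑ c : C, g (bias c.1) = ∑ w ∈ S, weightCount C w * g (Fintype.card ι - 2 * w) := by
  rw [← sum_fiberwise_of_maps_to (t := S) (g := fun c : C => weight c.1)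
    (fun c _ => hS c.1 c.2)]
  refine sum_congr rfl fun w _ => ?_
  rw [weightCount, ← nsmul_eq_mul]
  refine sum_eq_card_nsmul fun c hc => ?_
  rw [bias_eq, (mem_filter.mp hc).2]

theorem card_eq_sum_weightCount (S : Finset ℕ) (hS : ∀ c ∈ C, weight c ∈ S) :
    (Fintype.card C : ℤ) = ∑ w ∈ S, (weightCount C w : ℤ) := by
  simpa using sum_comp_bias S hS (fun _ => 1)

end

/-! ### Lengths excluded by residuals. -/

/-- `n` is the length of an effective `Δ`-divisible binary code. -/
def IsEffectiveLength (Δ n : ℕ) : Prop :=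
  ∃ (ι : Type u) (_ : Fintype ι) (C : Submodule (ZMod 2) (ι → ZMod 2)),
    IsEffective C ∧ IsDivisible Δ C ∧ Fintype.card ι = n

/-- `n` is the length of a projective `Δ`-divisible binary code. -/
def IsProjectiveLength (Δ n : ℕ) : Prop :=
  ∃ (ι : Type u) (_ : Fintype ι) (C : Submodule (ZMod 2) (ι → ZMod 2)),
    IsEffective C ∧ IsProjective C ∧ IsDivisible Δ C ∧ Fintype.card ι = n

theorem IsProjectiveLength.isEffectiveLength {Δ n : ℕ} :
    IsProjectiveLength.{u} Δ n → IsEffectiveLength.{u} Δ n :=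
  fun ⟨ι, _, C, he, _, hd, hn⟩ => ⟨ι, _, C, he, hd, hn⟩

theorem IsEffectiveLength.exists_residual {Δ n : ℕ} (h : IsEffectiveLength.{u} (2 * Δ) n)
    (hn : 0 < n) :
    ∃ x, n < 2 * (2 * Δ * x) ∧ 2 * Δ * x ≤ n ∧ IsEffectiveLength.{u} Δ (n - 2 * Δ * x) := by
  obtain ⟨ι, _, C, he, hd, rfl⟩ := h
  have : Nonempty ι := Fintype.card_pos_iff.mp hn
  obtain ⟨c, hc, hlt⟩ := exists_card_lt_two_mul_weight he
  obtain ⟨x, hx⟩ := hd c hc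
  have h1 := card_zeros c
  rw [hx] at h1 hlt
  exact ⟨x, hlt, by omega, _, _, residual C c, he.residual c, hd.residual hc, by omega⟩

theorem not_isEffectiveLength_of_lt {Δ n : ℕ} (hn : 0 < n) (h : n < Δ) :
    ¬ IsEffectiveLength.{u} Δ n := by
  rintro ⟨ι, _, C, he, hd, rfl⟩
  have : Nonempty ι := Fintype.card_pos_iff.mp hn
  obtain ⟨c, hc, hlt⟩ := exists_card_lt_two_mul_weight he
  have h1 := Nat.le_of_dvd (by omega) (hd c hc)
  have h2 := weight_le c
  omega

theorem not_isEffectiveLength_eight_nineteen : ¬ IsEffectiveLength.{u} 8 19 := by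
  intro h
  obtain ⟨x, h1, h2, h3⟩ := IsEffectiveLength.exists_residual (Δ := 4) h (by omega)
  obtain rfl : x = 2 := by omega
  exact not_isEffectiveLength_of_lt (by omega) (by omega) h3

theorem not_isEffectiveLength_sixteen_nineteen : ¬ IsEffectiveLength.{u} 16 19 := by
  intro h
  obtain ⟨x, h1, h2, h3⟩ := IsEffectiveLength.exists_residual (Δ := 8) h (by omega)
  obtain rfl : x = 1 := by omega
  exact not_isEffectiveLength_of_lt (by omega) (by omega) h3

theorem not_isEffectiveLength_sixteen_thirtyNine : ¬ IsEffectiveLength.{u} 16 39 := by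
  intro h
  obtain ⟨x, h1, h2, h3⟩ := IsEffectiveLength.exists_residual (Δ := 8) h (by omega)
  obtain rfl : x = 2 := by omega
  exact not_isEffectiveLength_of_lt (by omega) (by omega) h3

theorem not_isEffectiveLength_sixteen_fiftyOne : ¬ IsEffectiveLength.{u} 16 51 := by
  intro h
  obtain ⟨x, h1, h2, h3⟩ := IsEffectiveLength.exists_residual (Δ := 8) h (by omega)
  obtain rfl | rfl : x = 2 ∨ x = 3 := by omega
  · exact not_isEffectiveLength_eight_nineteen h3
  · exact not_isEffectiveLength_of_lt (by omega) (by omega) h3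

theorem not_isEffectiveLength_thirtyTwo_147 : ¬ IsEffectiveLength.{u} 32 147 := by
  intro h
  obtain ⟨x, h1, h2, h3⟩ := IsEffectiveLength.exists_residual (Δ := 16) h (by omega)
  obtain rfl | rfl : x = 3 ∨ x = 4 := by omega
  · exact not_isEffectiveLength_sixteen_fiftyOne h3
  · exact not_isEffectiveLength_sixteen_nineteen h3

theorem not_isEffectiveLength_thirtyTwo_135 : ¬ IsEffectiveLength.{u} 32 135 := by
  intro h
  obtain ⟨x, h1, h2, h3⟩ := IsEffectiveLength.exists_residual (Δ := 16) h (by omega)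
  obtain rfl | rfl : x = 3 ∨ x = 4 := by omega
  · exact not_isEffectiveLength_sixteen_thirtyNine h3
  · exact not_isEffectiveLength_of_lt (by omega) (by omega) h3

section

variable {ι : Type u} [Fintype ι] {C : Submodule (ZMod 2) (ι → ZMod 2)}

theorem isProjectiveLength_residual {Δ : ℕ} (he : IsEffective C) (hp : IsProjective C)
    (hd : IsDivisible (2 * Δ) C) {c : ι → ZMod 2} (hc : c ∈ C) :
    IsProjectiveLength.{u} Δ (Fintype.card ι - weight c) :=
  ⟨_, _, residual C c, he.residual c, hp.residual c, hd.residual hc, by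
    have := card_zeros c; omega⟩

end

/-! ### Projective lengths 11, 35 and 51. -/

theorem not_isProjectiveLength_four_eleven : ¬ IsProjectiveLength.{u} 4 11 := by
  rintro ⟨ι, _, C, he, hp, hd, hn⟩
  have h1 : ∀ c ∈ C, weight c ∈ ({0, 4, 8} : Finset ℕ) := by
    intro c hc
    obtain ⟨x, hx⟩ := hd c hc
    have := weight_le c
    simp only [mem_insert, mem_singleton]
    omega
  have e0 := card_eq_sum_weightCount _ h1
  have e1 := sum_comp_bias _ h1 (fun z => z)
  have e2 := sum_comp_bias _ h1 (fun z => z ^ 2)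
  rw [sum_bias he] at e1
  rw [sum_bias_sq hp] at e2
  have := weightCount_zero (C := C)
  simp [hn] at e0 e1 e2
  -- Summing `(z - 3) * (z + 5)` over the biases `z` gives `-4 * |C| = 128`.
  omega

theorem not_isProjectiveLength_eight_thirtyFive : ¬ IsProjectiveLength.{u} 8 35 := by
  rintro ⟨ι, _, C, he, hp, hd, hn⟩
  have : Nonempty ι := Fintype.card_pos_iff.mp (by omega)
  obtain ⟨c, hc, hlt⟩ := exists_card_lt_two_mul_weight he
  have h1 := isProjectiveLength_residual (Δ := 4) he hp hd hc
  obtain ⟨x, hx⟩ := hd c hc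
  have h2 := weight_le c
  rw [hn, hx] at h1
  obtain rfl | rfl : x = 3 ∨ x = 4 := by omega
  · exact not_isProjectiveLength_four_eleven h1
  · exact not_isEffectiveLength_of_lt (by omega) (by omega) h1.isEffectiveLength

section

variable {ι : Type u} [Fintype ι] {C : Submodule (ZMod 2) (ι → ZMod 2)}

theorem weight_mem_of_card_fiftyOne (he : IsEffective C) (hp : IsProjective C)
    (hd : IsDivisible 8 C) (hn : Fintype.card ι = 51) :
    ∀ c ∈ C, weight c ∈ ({0, 8, 16, 24, 32} : Finset ℕ) := by
  intro c hc
  have h1 := isProjectiveLength_residual (Δ := 4) he hp hd hc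
  obtain ⟨x, hx⟩ := hd c hc
  have h2 := weight_le c
  rw [hn, hx] at h1
  have h5 : x ≠ 5 := by
    rintro rfl
    exact not_isProjectiveLength_four_eleven h1
  have h6 : x ≠ 6 := by
    rintro rfl
    exact not_isEffectiveLength_of_lt (by omega) (by omega) h1.isEffectiveLength
  simp only [mem_insert, mem_singleton]
  omega

theorem eq_or_eq_of_eq_two_pow {N k : ℕ} (h : N = 2 ^ k) (h1 : 256 ≤ N) (h2 : N ≤ 546) :
    N = 256 ∨ N = 512 := by
  obtain rfl | rfl | hk | hk : k = 8 ∨ k = 9 ∨ k ≤ 7 ∨ 10 ≤ k := by omega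
  · exact .inl h
  · exact .inr h
  · have := Nat.pow_le_pow_right (n := 2) (by omega) hk
    omega
  · have := Nat.pow_le_pow_right (n := 2) (by omega) hk
    omega

theorem card_eq_of_card_fiftyOne (he : IsEffective C) (hp : IsProjective C)
    (hd : IsDivisible 8 C) (hn : Fintype.card ι = 51) :
    Fintype.card C = 256 ∧ weightCount C 8 = 0 ∧ weightCount C 16 = 0 := by
  have h1 := weight_mem_of_card_fiftyOne he hp hd hn
  have e0 := card_eq_sum_weightCount _ h1
  have e1 := sum_comp_bias _ h1 (fun z => z)
  have e2 := sum_comp_bias _ h1 (fun z => z ^ 2)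
  have e3 := sum_comp_bias _ h1 (fun z => z ^ 3)
  have e4 := sum_bias_cube_nonneg (C := C)
  rw [sum_bias he] at e1
  rw [sum_bias_sq hp] at e2
  rw [e3] at e4
  have hz := weightCount_zero (C := C)
  simp [hn, hz] at e0 e1 e2 e4
  obtain ⟨k, hk⟩ : ∃ k, Fintype.card C = 2 ^ k :=
    ⟨_, by rw [Module.card_eq_pow_finrank (K := ZMod 2) (V := C), ZMod.card]⟩
  have key : Fintype.card C = 256 ∧ weightCount C 8 = 0 ∧ weightCount C 16 = 0 ∨
      weightCount C 8 = 2 ∧ weightCount C 16 = 0 := by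
    generalize Fintype.card C = N at *
    generalize weightCount C 8 = a at *
    generalize weightCount C 16 = b at *
    generalize weightCount C 24 = c at *
    generalize weightCount C 32 = d at *
    -- Sum `(z - 3) * (z + 13)` over the biases; for `q2`, insert the factor `z - 19` and drop the
    -- nonnegative third moment.
    have q1 : 3 * (N : ℤ) = 128 * (b + 3 * a + 6) := by linarith
    have q2 : 282 * (N : ℤ) ≤ 8192 * (3 * a + 12) := by linarith
    clear e0 e1 e2 e4
    obtain rfl | rfl := eq_or_eq_of_eq_two_pow hk (by omega) (by omega)
    · omega
    · omega
  -- The sum of the two words of weight 8 would be a third one.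
  refine key.resolve_right ?_
  rintro ⟨h8, h16⟩
  obtain ⟨c, d, hcd, hs⟩ := card_eq_two.mp h8
  have hmem : ∀ x : C, weight x.1 = 8 → x = c ∨ x = d := fun x hx => by
    have h : x ∈ ({y : C | weight y.1 = 8} : Finset C) := by simpa using hx
    rwa [hs, mem_insert, mem_singleton] at h
  have hc : weight c.1 = 8 := by
    have h := mem_insert_self c {d}
    rw [← hs] at h
    exact (mem_filter.mp h).2
  have hd' : weight d.1 = 8 := by
    have h := mem_insert_of_mem (b := c) (mem_singleton_self d)
    rw [← hs] at h
    exact (mem_filter.mp h).2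
  have h0 : weight (c.1 + d.1) ≠ 0 := by
    rw [Ne, weight_eq_zero]
    intro h
    refine hcd (Subtype.ext ?_)
    funext i
    exact CharTwo.add_eq_zero.mp (congrFun h i)
  have hm := h1 _ (C.add_mem c.2 d.2)
  have hn16 : weight (c.1 + d.1) ≠ 16 := by
    intro h
    exact filter_eq_empty_iff.mp (card_eq_zero.mp h16) (mem_univ (c + d)) h
  have h3 := weight_add_le c.1 d.1
  have hm8 : weight (c.1 + d.1) = 8 := by
    simp only [mem_insert, mem_singleton] at hm
    omega
  have := hmem (c + d) hm8
  rw [add_eq_left, add_eq_right] at this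
  rcases this with h | h <;> simp [h] at hc hd'

end

/-! ### Projective length 131. -/

section

theorem add_add_cancel_self {ι : Type*} (c d : ι → ZMod 2) : c + (c + d) = d := by
  funext i
  simp [← add_assoc, CharTwo.add_self_eq_zero]

variable {ι : Type u} [Fintype ι] {C : Submodule (ZMod 2) (ι → ZMod 2)}

theorem weight_mem_of_card_131 (he : IsEffective C) (hp : IsProjective C)
    (hd : IsDivisible 16 C) (hn : Fintype.card ι = 131) :
    ∀ c ∈ C, weight c ∈ ({0, 16, 32, 48, 64, 80} : Finset ℕ) := by
  intro c hc
  have h1 := isProjectiveLength_residual (Δ := 8) he hp hd hc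
  obtain ⟨x, hx⟩ := hd c hc
  have h2 := weight_le c
  rw [hn, hx] at h1
  have h6 : x ≠ 6 := by
    rintro rfl
    exact not_isProjectiveLength_eight_thirtyFive h1
  have h7 : x ≠ 7 := by
    rintro rfl
    exact not_isEffectiveLength_eight_nineteen h1.isEffectiveLength
  have h8 : x ≠ 8 := by
    rintro rfl
    exact not_isEffectiveLength_of_lt (by omega) (by omega) h1.isEffectiveLength
  simp only [mem_insert, mem_singleton]
  omega

theorem card_residual_of_weight_eq_80 (he : IsEffective C) (hp : IsProjective C)
    (hd : IsDivisible 16 C) (hn : Fintype.card ι = 131) {c : ι → ZMod 2} (hc : c ∈ C)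
    (hw : weight c = 80) :
    Fintype.card (residual C c) = 256 ∧
      ∀ d ∈ C, weight (restrict c d) ∈ ({0, 24, 32} : Finset ℕ) := by
  have h1 := card_zeros c
  have h2 : IsDivisible 8 (residual C c) := IsDivisible.residual (Δ := 8) hd hc
  have hn' : Fintype.card {i // c i = 0} = 51 := by omega
  obtain ⟨h3, h4, h5⟩ := card_eq_of_card_fiftyOne (he.residual c) (hp.residual c) h2 hn'
  refine ⟨h3, fun d hd => ?_⟩
  have hr := restrict_mem_residual c hd
  have h6 := weight_mem_of_card_fiftyOne (he.residual c) (hp.residual c) h2 hn' _ hr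
  have h7 : weight (restrict c d) ≠ 8 :=
    filter_eq_empty_iff.mp (card_eq_zero.mp h4) (mem_univ ⟨_, hr⟩)
  have h8 : weight (restrict c d) ≠ 16 :=
    filter_eq_empty_iff.mp (card_eq_zero.mp h5) (mem_univ ⟨_, hr⟩)
  simp only [mem_insert, mem_singleton] at h6 ⊢
  omega

/-- Words `d` vanishing off the support of `c` pair with `c + d`, the weights adding to 80, so one
in each pair has weight at most 32. Conversely, a word that light restricts to 0: otherwise its
partner would weigh at least 96. -/
theorem card_eq_of_card_131 (he : IsEffective C) (hp : IsProjective C)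
    (hd : IsDivisible 16 C) (hn : Fintype.card ι = 131) {c : ι → ZMod 2} (hc : c ∈ C)
    (hw : weight c = 80) :
    Fintype.card C = 512 * (1 + weightCount C 16 + weightCount C 32) := by
  classical
  have hm := weight_mem_of_card_131 he hp hd hn
  obtain ⟨h1, h2⟩ := card_residual_of_weight_eq_80 he hp hd hn hc hw
  have hsum := weight_add_weight_add c
  simp only [mem_insert, mem_singleton] at hm h2
  have hsmall : #{d : C | weight d.1 ≤ 32} = 1 + weightCount C 16 + weightCount C 32 := by
    rw [← weightCount_zero (C := C), weightCount, weightCount, weightCount,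
      ← card_union_of_disjoint, ← card_union_of_disjoint]
    · congr 1
      ext d
      have := hm d.1 d.2
      simp only [mem_filter, mem_univ, true_and, mem_union]
      omega
    · rw [← filter_or]
      refine disjoint_filter.mpr fun d _ => ?_
      omega
    · refine disjoint_filter.mpr fun d _ => ?_
      omega
  have hlow : #{d : C | restrict c d.1 = 0 ∧ weight d.1 ≤ 32} = #{d : C | weight d.1 ≤ 32} := by
    congr 1
    ext d
    simp only [mem_filter, mem_univ, true_and, and_iff_right_iff_imp]
    intro hle
    have := hm d.1 d.2
    have := hm _ (C.add_mem hc d.2)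
    have := h2 d.1 d.2
    have := hsum d.1
    rw [← weight_eq_zero]
    omega
  have hhigh : #{d : C | restrict c d.1 = 0 ∧ ¬ weight d.1 ≤ 32} =
      #{d : C | restrict c d.1 = 0 ∧ weight d.1 ≤ 32} := by
    have hswap : ∀ d : C, restrict c d.1 = 0 → restrict c (c + d.1) = 0 := fun d h => by
      funext i
      have := congrFun h i
      simp only [restrict, Pi.zero_apply, Pi.add_apply] at this ⊢
      rw [i.2, this, add_zero]
    refine card_nbij' (fun d => ⟨c, hc⟩ + d) (fun d => ⟨c, hc⟩ + d) ?_ ?_ ?_ ?_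
    · intro d hd
      simp only [coe_filter, mem_univ, true_and, Set.mem_ofPred_eq, Submodule.coe_add] at hd ⊢
      refine ⟨hswap d hd.1, ?_⟩
      have := hsum d.1
      have := hm d.1 d.2
      have := hm _ (C.add_mem hc d.2)
      have := weight_eq_zero.mpr hd.1
      omega
    · intro d hd
      simp only [coe_filter, mem_univ, true_and, Set.mem_ofPred_eq, Submodule.coe_add] at hd ⊢
      refine ⟨hswap d hd.1, ?_⟩
      have := hsum d.1
      have := hm d.1 d.2
      have := hm _ (C.add_mem hc d.2)
      have := weight_eq_zero.mpr hd.1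
      omega
    · exact fun d _ => Subtype.ext (add_add_cancel_self c d.1)
    · exact fun d _ => Subtype.ext (add_add_cancel_self c d.1)
  have hD := card_filter_add_card_filter_not (s := {d : C | restrict c d.1 = 0})
    (fun d : C => weight d.1 ≤ 32)
  rw [filter_filter, filter_filter, hhigh, hlow, hsmall] at hD
  rw [card_eq_card_residual_mul c, h1, ← hD]
  ring

theorem not_isProjectiveLength_sixteen_131 : ¬ IsProjectiveLength.{u} 16 131 := by
  classical
  rintro ⟨ι, _, C, he, hp, hd, hn⟩
  have : Nonempty ι := Fintype.card_pos_iff.mp (by omega)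
  have hm := weight_mem_of_card_131 he hp hd hn
  obtain ⟨c, hc, hlt⟩ := exists_card_lt_two_mul_weight he
  have hw : weight c = 80 := by
    have := hm c hc
    simp only [mem_insert, mem_singleton] at this
    omega
  have hcard := card_eq_of_card_131 he hp hd hn hc hw
  have e0 := card_eq_sum_weightCount _ hm
  have e1 := sum_comp_bias _ hm (fun z => z)
  have e2 := sum_comp_bias _ hm (fun z => z ^ 2)
  rw [sum_bias he] at e1
  rw [sum_bias_sq hp] at e2
  have hz := weightCount_zero (C := C)
  simp [hn, hz, hcard] at e0 e1 e2
  have q48 : (weightCount C 48 : ℤ) = 1 + 5 * weightCount C 16 + 8 * weightCount C 32 := by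
    linarith
  have q80 : (weightCount C 80 : ℤ) = 53 + 56 * weightCount C 16 + 58 * weightCount C 32 := by
    linarith
  clear e0 e1 e2 hcard
  have hpair : ∀ c ∈ C, weight c = 80 → ∀ d ∈ C,
      weight (c + d) + weight d ∈ ({80, 128, 144} : Finset ℕ) := by
    intro c hc hw d hdC
    have h1 := (card_residual_of_weight_eq_80 he hp hd hn hc hw).2 d hdC
    have h2 := weight_add_weight_add c d
    simp only [mem_insert, mem_singleton] at h1 ⊢
    omega
  simp only [mem_insert, mem_singleton] at hm hpair
  -- Without weight 32, adding a word of weight 48 is a fixed-point-free involution on weight 80,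
  -- whose count is odd by `q80`. Otherwise adding a word of weight 32 injects weight 80 into weight
  -- 48, against `q48` and `q80`.
  by_cases h32 : weightCount C 32 = 0
  · have hpos : 0 < weightCount C 48 := by omega
    obtain ⟨y, hy⟩ := card_pos.mp hpos
    replace hy : weight y.1 = 48 := by simpa using hy
    have hy0 : y ≠ 0 := by
      rintro rfl
      simp at hy
    have hodd : ((weightCount C 80 : ℕ) : ZMod 2) = 0 := by
      rw [weightCount, card_eq_sum_ones, Nat.cast_sum]
      refine sum_involution (fun d _ => y + d) (fun _ _ => by decide) ?_ ?_ ?_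
      · intro d _ _ h
        exact hy0 (add_eq_right.mp h)
      · intro d hd
        simp only [mem_filter, mem_univ, true_and, Submodule.coe_add] at hd ⊢
        have h1 := hpair d.1 d.2 hd y.1 y.2
        have h2 := hm _ (C.add_mem d.2 y.2)
        have h3 : weight (d.1 + y.1) ≠ 32 :=
          filter_eq_empty_iff.mp (card_eq_zero.mp h32) (mem_univ (d + y))
        rw [add_comm]
        omega
      · exact fun d _ => Subtype.ext (add_add_cancel_self y.1 d.1)
    rw [ZMod.natCast_eq_zero_iff] at hodd
    omega
  · obtain ⟨x, hx⟩ := card_pos.mp (Nat.pos_of_ne_zero h32)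
    replace hx : weight x.1 = 32 := by simpa using hx
    have hle : weightCount C 80 ≤ weightCount C 48 := by
      refine card_le_card_of_injOn (fun d => x + d) ?_ (add_right_injective x).injOn
      intro d hd
      simp only [coe_filter, mem_univ, true_and, Set.mem_ofPred_eq, Submodule.coe_add] at hd ⊢
      have h1 := hpair d.1 d.2 hd x.1 x.2
      have h2 := hm _ (C.add_mem d.2 x.2)
      rw [add_comm]
      omega
    omega

end

end BinaryCode

/-! ### Divisible codes from families of subspaces. -/

section

variable {V : Type u} [AddCommGroup V] [Module (ZMod 2) V] [Fintype V]

theorem card_submodule_eq_two_pow (U : Submodule (ZMod 2) V) :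
    Nat.card U = 2 ^ Module.finrank (ZMod 2) U := by
  rw [Module.natCard_eq_pow_finrank (K := ZMod 2), Nat.card_zmod]

open Classical in
theorem dvd_card_filter_ne_zero_and_mem {k : ℕ} (U : Submodule (ZMod 2) V)
    (hU : Module.finrank (ZMod 2) U = k + 1) (f : Module.Dual (ZMod 2) V) :
    2 ^ k ∣ #{v | f v ≠ 0 ∧ v ∈ U} := by
  by_cases h : ∃ v : U, f v.1 ≠ 0
  · have h1 := two_mul_card_filter_ne_zero (f.toAddMonoidHom.comp U.toAddSubgroup.subtype) h
    have h2 : #{v | f v ≠ 0 ∧ v ∈ U} =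
        #{v | (f.toAddMonoidHom.comp U.toAddSubgroup.subtype) v ≠ 0} := by
      symm
      refine card_bij (fun v _ => v.1) ?_ (fun _ _ _ _ h => Subtype.ext h) ?_
      · intro v hv
        exact mem_filter.mpr ⟨mem_univ _, (mem_filter.mp hv).2, v.2⟩
      · intro v hv
        have h := (mem_filter.mp hv).2
        exact ⟨⟨v, h.2⟩, mem_filter.mpr ⟨mem_univ _, h.1⟩, rfl⟩
    have h3 := card_submodule_eq_two_pow U
    rw [hU, Nat.card_eq_fintype_card, pow_succ] at h3
    have h4 : Fintype.card U.toAddSubgroup = Fintype.card U := rfl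
    rw [h2, show #{v | (f.toAddMonoidHom.comp U.toAddSubgroup.subtype) v ≠ 0} = 2 ^ k by omega]
  · push Not at h
    rw [filter_eq_empty_iff.mpr]
    · simp
    · rintro v - ⟨h1, h2⟩
      exact h1 (h ⟨v, h2⟩)

open Classical in
/-- A family of `(k + 1)`-dimensional subspaces that covers each nonzero vector at most `l` times
yields a `2 ^ k`-divisible code, whose coordinates are the missing vectors. -/
theorem exists_code_of_card_filter_mem_le {k l : ℕ} (P : Finset (Submodule (ZMod 2) V))
    (hk : ∀ U ∈ P, Module.finrank (ZMod 2) U = k + 1)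
    (hV : 2 ^ (k + 1) ∣ Fintype.card V)
    (hl : ∀ v ≠ 0, #{U ∈ P | v ∈ U} ≤ l) :
    ∃ (ι : Type u) (_ : Fintype ι) (C : Submodule (ZMod 2) (ι → ZMod 2)),
      BinaryCode.IsEffective C ∧ (l = 1 → BinaryCode.IsProjective C) ∧
      BinaryCode.IsDivisible (2 ^ k) C ∧
      Fintype.card ι + #P * (2 ^ (k + 1) - 1) = l * (Fintype.card V - 1) := by
  -- The second component indexes the copies of `v`, as many as its deficit from `l`.
  let D (S : Finset V) : Finset (Σ _ : V, ℕ) :=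
    S.sigma fun v => Ico #{U ∈ P | v ∈ U} l
  have hD : ∀ S : Finset V, (0 : V) ∉ S → #(D S) + ∑ U ∈ P, #{v ∈ S | v ∈ U} = l * #S := by
    intro S hS
    have h1 : ∑ U ∈ P, #{v ∈ S | v ∈ U} = ∑ v ∈ S, #{U ∈ P | v ∈ U} := by
      simp only [card_filter]
      exact sum_comm
    rw [card_sigma, h1, ← sum_add_distrib, mul_comm, ← smul_eq_mul]
    refine sum_eq_card_nsmul fun v hv => ?_
    rw [Nat.card_Ico]
    exact Nat.sub_add_cancel (hl v fun h => hS (h ▸ hv))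
  let I : Finset (Σ _ : V, ℕ) := D {v | v ≠ 0}
  have hI : ∀ i : I, i.1.1 ≠ 0 := fun i => (mem_filter.mp (mem_sigma.mp i.2).1).2
  let L : Module.Dual (ZMod 2) V →ₗ[ZMod 2] (I → ZMod 2) :=
    LinearMap.pi fun i => LinearMap.applyₗ i.1.1
  have hsep : ∀ v : V, v ≠ 0 → ∃ f : Module.Dual (ZMod 2) V, f v ≠ 0 := fun v hv => by
    by_contra! h
    exact hv ((Module.forall_dual_apply_eq_zero_iff (ZMod 2) v).mp h)
  refine ⟨I, inferInstance, LinearMap.range L, ?_, ?_, ?_, ?_⟩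
  · intro i
    obtain ⟨f, hf⟩ := hsep _ (hI i)
    exact ⟨L f, ⟨f, rfl⟩, hf⟩
  · rintro rfl i j hij
    have hne : i.1.1 ≠ j.1.1 := by
      intro h
      have hi := (mem_Ico.mp (mem_sigma.mp i.2).2).2
      have hj := (mem_Ico.mp (mem_sigma.mp j.2).2).2
      exact hij (Subtype.ext (Sigma.ext h (heq_of_eq (by omega))))
    obtain ⟨f, hf⟩ := hsep _ (sub_ne_zero.mpr hne)
    refine ⟨L f, ⟨f, rfl⟩, fun h => hf ?_⟩
    rw [map_sub]
    exact sub_eq_zero.mpr h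
  · rintro _ ⟨f, rfl⟩
    have hw : BinaryCode.weight (L f) = #(D {v | f v ≠ 0}) := by
      refine card_bij (fun i _ => i.1) ?_ (fun _ _ _ _ h => Subtype.ext h) ?_
      · intro i hi
        exact mem_sigma.mpr ⟨mem_filter.mpr ⟨mem_univ _, (mem_filter.mp hi).2⟩,
          (mem_sigma.mp i.2).2⟩
      · intro x hx
        have h1 := mem_sigma.mp hx
        have h2 := (mem_filter.mp h1.1).2
        refine ⟨⟨x, mem_sigma.mpr ⟨mem_filter.mpr ⟨mem_univ _, ?_⟩, h1.2⟩⟩,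
          mem_filter.mpr ⟨mem_univ _, h2⟩, rfl⟩
        rintro h0
        exact h2 (by rw [h0, map_zero])
    have h1 := hD {v | f v ≠ 0} (by simp)
    rw [hw]
    -- Off the hyperplane `f = 0`, both the members' total and `l` copies of all vectors are
    -- divisible by `2 ^ k`.
    refine (Nat.dvd_add_left (c := ∑ U ∈ P, #{v ∈ ({v | f v ≠ 0} : Finset V) | v ∈ U}) ?_).mp ?_
    · refine dvd_sum fun U hU => ?_
      rw [filter_filter]
      exact dvd_card_filter_ne_zero_and_mem U (hk U hU) f
    · rw [h1]
      refine Dvd.dvd.mul_left ?_ _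
      by_cases hf : ∃ v, f v ≠ 0
      · have h2 := two_mul_card_filter_ne_zero f.toAddMonoidHom hf
        rw [← h2, pow_succ, mul_comm] at hV
        exact Nat.dvd_of_mul_dvd_mul_left two_pos hV
      · push Not at hf
        simp [hf]
  · have h1 := hD {v | v ≠ 0} (by simp)
    have h2 : #{v : V | v ≠ 0} = Fintype.card V - 1 := by
      rw [filter_ne' univ (0 : V), card_erase_of_mem (mem_univ _), card_univ]
    rw [Fintype.card_coe, ← h2, ← h1]
    congr 1
    rw [← smul_eq_mul]
    symm
    refine sum_eq_card_nsmul fun U hU => ?_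
    have h3 := card_submodule_eq_two_pow U
    rw [hk U hU, Nat.card_eq_fintype_card, Fintype.card_subtype] at h3
    rw [← h3, filter_filter, ← card_erase_of_mem (mem_filter.mpr ⟨mem_univ _, U.zero_mem⟩)]
    congr 1
    ext v
    simp

end

/-! ### Quotients and intersection bounds. -/

theorem map_mkQ_inf_map_mkQ {V : Type*} [AddCommGroup V] [Module (ZMod 2) V]
    {N U W : Submodule (ZMod 2) V} (hW : N ≤ W) :
    U.map N.mkQ ⊓ W.map N.mkQ = (U ⊓ W).map N.mkQ := by
  rw [Submodule.map_inf_eq_map_inf_comap, Submodule.comap_map_mkQ, sup_eq_right.mpr hW]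

section

variable {V : Type*} [AddCommGroup V] [Module (ZMod 2) V] [Finite V]

theorem finrank_map_mkQ_span_singleton_add_one {v : V} (hv : v ≠ 0) (U : Submodule (ZMod 2) V)
    (hU : v ∈ U) :
    Module.finrank (ZMod 2) (U.map (Submodule.span (ZMod 2) {v}).mkQ) + 1 =
      Module.finrank (ZMod 2) U := by
  have h1 := LinearMap.finrank_range_add_finrank_ker
    ((Submodule.span (ZMod 2) {v}).mkQ.domRestrict U)
  rw [LinearMap.range_domRestrict, LinearMap.ker_domRestrict, Submodule.ker_mkQ] at h1
  rw [← h1, ← finrank_span_singleton (K := ZMod 2) hv]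
  congr 1
  refine (LinearEquiv.finrank_eq (Submodule.comapSubtypeEquivOfLe ?_)).symm
  rwa [Submodule.span_singleton_le_iff_mem]

end

/-- A family of `k`-dimensional subspaces of an `n`-dimensional binary space that pairwise
intersect in dimension at most `t` has at most `B` members. -/
def IsIntersectionBound (n k t B : ℕ) : Prop :=
  ∀ (V : Type) [AddCommGroup V] [Module (ZMod 2) V] [Fintype V] (P : Finset (Submodule (ZMod 2) V)),
    Module.finrank (ZMod 2) V = n → (∀ U ∈ P, Module.finrank (ZMod 2) U = k) →
    (∀ U ∈ P, ∀ W ∈ P, U ≠ W → Module.finrank (ZMod 2) (U ⊓ W : Submodule (ZMod 2) V) ≤ t) →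
    #P ≤ B

theorem card_eq_two_pow {V : Type*} [AddCommGroup V] [Module (ZMod 2) V] [Fintype V] {n : ℕ}
    (hn : Module.finrank (ZMod 2) V = n) : Fintype.card V = 2 ^ n := by
  rw [Module.card_eq_pow_finrank (K := ZMod 2), ZMod.card, hn]

section

variable {V : Type} [AddCommGroup V] [Module (ZMod 2) V] [Fintype V]
  {P : Finset (Submodule (ZMod 2) V)} {n k t B : ℕ}

open Classical in
/-- Passing to the quotient by a nonzero vector bounds the number of members through it. -/
theorem IsIntersectionBound.card_filter_mem_le (h : IsIntersectionBound n k t B)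
    (hn : Module.finrank (ZMod 2) V = n + 1) (hk : ∀ U ∈ P, Module.finrank (ZMod 2) U = k + 1)
    (ht : ∀ U ∈ P, ∀ W ∈ P, U ≠ W →
      Module.finrank (ZMod 2) (U ⊓ W : Submodule (ZMod 2) V) ≤ t + 1)
    {v : V} (hv : v ≠ 0) : #{U ∈ P | v ∈ U} ≤ B := by
  have hspan : ∀ {U}, v ∈ U → Submodule.span (ZMod 2) {v} ≤ U := fun hU => by
    rwa [Submodule.span_singleton_le_iff_mem]
  have hinj : Set.InjOn (Submodule.map (Submodule.span (ZMod 2) {v}).mkQ)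
      ({U ∈ P | v ∈ U} : Finset (Submodule (ZMod 2) V)) := by
    intro U hU W hW hUW
    have h1 := congrArg (Submodule.comap (Submodule.span (ZMod 2) {v}).mkQ) hUW
    rwa [Submodule.comap_map_mkQ, Submodule.comap_map_mkQ,
      sup_eq_right.mpr (hspan (mem_filter.mp hU).2),
      sup_eq_right.mpr (hspan (mem_filter.mp hW).2)] at h1
  rw [← card_image_of_injOn hinj]
  have : Fintype (V ⧸ Submodule.span (ZMod 2) {v}) := Fintype.ofFinite _
  refine h _ _ ?_ ?_ ?_
  · have h1 := Submodule.finrank_quotient_add_finrank (Submodule.span (ZMod 2) {v})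
    rw [finrank_span_singleton hv] at h1
    omega
  · intro X hX
    obtain ⟨U, hU, rfl⟩ := mem_image.mp hX
    obtain ⟨hU, hvU⟩ := mem_filter.mp hU
    have h1 := finrank_map_mkQ_span_singleton_add_one hv U hvU
    have h2 := hk U hU
    omega
  · intro X hX Y hY hXY
    obtain ⟨U, hU, rfl⟩ := mem_image.mp hX
    obtain ⟨W, hW, rfl⟩ := mem_image.mp hY
    obtain ⟨hU, hvU⟩ := mem_filter.mp hU
    obtain ⟨hW, hvW⟩ := mem_filter.mp hW
    rw [map_mkQ_inf_map_mkQ (hspan hvW)]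
    have h1 := finrank_map_mkQ_span_singleton_add_one hv (U ⊓ W) ⟨hvU, hvW⟩
    have h2 := ht U hU W hW (fun h => hXY (by rw [h]))
    omega

end

/-- There is no partial spread of five-dimensional subspaces with exactly 131 holes. -/
theorem isIntersectionBound_five_zero {n B : ℕ} (hn : 5 ≤ n) (hB : 2 ^ n = 132 + (B + 1) * 31) :
    IsIntersectionBound n 5 0 B := by
  classical
  intro V _ _ _ P hV hk ht
  by_contra! hlt
  -- Exactly `B + 1` members leave 131 holes; the 132 in `hB` includes the zero vector.
  obtain ⟨Q, hQP, hQ⟩ := exists_subset_card_eq (show B + 1 ≤ #P from hlt)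
  have hcard := card_eq_two_pow hV
  obtain ⟨ι, _, C, he, hp, hd, hι⟩ := exists_code_of_card_filter_mem_le (k := 4) (l := 1) Q
    (fun U hU => hk U (hQP hU)) (by rw [hcard]; exact pow_dvd_pow 2 hn) (by
      intro v hv
      rw [card_le_one]
      intro U hU W hW
      obtain ⟨hU, hvU⟩ := mem_filter.mp hU
      obtain ⟨hW, hvW⟩ := mem_filter.mp hW
      by_contra hne
      have h1 := ht U (hQP hU) W (hQP hW) hne
      rw [Nat.le_zero, Submodule.finrank_eq_zero] at h1
      have h2 : v ∈ U ⊓ W := ⟨hvU, hvW⟩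
      rw [h1] at h2
      exact hv ((Submodule.mem_bot _).mp h2))
  refine BinaryCode.not_isProjectiveLength_sixteen_131 ⟨ι, _, C, he, hp rfl, hd, ?_⟩
  rw [hcard, hQ, hB] at hι
  omega

/-- `L` is the total deficit if `B + 1` members existed, each with 63 nonzero vectors. -/
theorem IsIntersectionBound.six_one {n A B L : ℕ} (h : IsIntersectionBound n 5 0 A) (hn : 5 ≤ n)
    (hL : ¬ BinaryCode.IsEffectiveLength.{0} 32 L)
    (hB : A * (2 ^ (n + 1) - 1) = L + (B + 1) * 63) :
    IsIntersectionBound (n + 1) 6 1 B := by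
  classical
  intro V _ _ _ P hV hk ht
  by_contra! hlt
  obtain ⟨Q, hQP, hQ⟩ := exists_subset_card_eq (show B + 1 ≤ #P from hlt)
  have hcard := card_eq_two_pow hV
  obtain ⟨ι, _, C, he, -, hd, hι⟩ := exists_code_of_card_filter_mem_le (k := 5) (l := A) Q
    (fun U hU => hk U (hQP hU)) (by rw [hcard]; exact pow_dvd_pow 2 (by omega))
    (fun v hv => h.card_filter_mem_le hV (fun U hU => hk U (hQP hU))
      (fun U hU W hW => ht U (hQP hU) W (hQP hW)) hv)
  refine hL ⟨ι, _, C, he, hd, ?_⟩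
  rw [hcard, hQ, hB] at hι
  omega

/-- The Johnson bound. -/
theorem IsIntersectionBound.succ {n k t A B : ℕ} (h : IsIntersectionBound n k t A) (hn : k ≤ n)
    (hB : A * (2 ^ (n + 1) - 1) < (B + 1) * (2 ^ (k + 1) - 1)) :
    IsIntersectionBound (n + 1) (k + 1) (t + 1) B := by
  classical
  intro V _ _ _ P hV hk ht
  have hcard := card_eq_two_pow hV
  obtain ⟨ι, _, C, -, -, -, hι⟩ := exists_code_of_card_filter_mem_le (k := k) (l := A) P hk
    (by rw [hcard]; exact pow_dvd_pow 2 (by omega))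
    (fun v hv => h.card_filter_mem_le hV hk ht hv)
  rw [hcard] at hι
  have h1 : #P * (2 ^ (k + 1) - 1) < (B + 1) * (2 ^ (k + 1) - 1) := by omega
  exact Nat.lt_succ_iff.mp (Nat.lt_of_mul_lt_mul_right h1)

theorem IsIntersectionBound.maxCodeSize_le {n d k t B : ℕ} (h : IsIntersectionBound n k t B)
    (ht : 2 * k < d + 2 * (t + 1)) : maxCodeSize (ZMod 2) n d k ≤ B := by
  obtain ⟨C, hC, hcard⟩ := (isGreatest_maxCodeSize (ZMod 2) n d k).1
  rw [← hcard]
  refine h _ C (by simp) hC.1 fun U hU W hW hne => ?_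
  have h1 := hC.2 U hU W hW hne
  have h2 := subspaceDist_add U W
  rw [hC.1 U hU, hC.1 W hW] at h2
  omega

theorem isIntersectionBound_fourteen_six_one : IsIntersectionBound 14 6 1 67349 :=
  (isIntersectionBound_five_zero (n := 13) (B := 259) (by norm_num) (by norm_num)).six_one
    (by norm_num) BinaryCode.not_isEffectiveLength_thirtyTwo_147 (by norm_num)

theorem isIntersectionBound_nineteen_six_one : IsIntersectionBound 19 6 1 70329353 :=
  (isIntersectionBound_five_zero (n := 18) (B := 8451) (by norm_num) (by norm_num)).six_one
    (by norm_num) BinaryCode.not_isEffectiveLength_thirtyTwo_135 (by norm_num)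

theorem mainTheorem3 :
    maxCodeSize (ZMod 2) 14 10 6 ≤ 67349 ∧
    maxCodeSize (ZMod 2) 15 10 7 ≤ 17727975 ∧
    maxCodeSize (ZMod 2) 19 10 6 ≤ 70329353 :=
  ⟨isIntersectionBound_fourteen_six_one.maxCodeSize_le (by norm_num),
    (isIntersectionBound_fourteen_six_one.succ (B := 17727975) (by norm_num)
      (by norm_num)).maxCodeSize_le (by norm_num),
    isIntersectionBound_nineteen_six_one.maxCodeSize_le (by norm_num)⟩
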